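/- Equip $\ell_\infty^n$ with its natural operator space structure, $M_d(\ell_\infty^n)=\ell_\infty^n(M_d)$, and $\ell_1^n(\ell_\infty^n)$ with that of the $\ell_1$-direct sum of $n$ copies of $\ell_\infty^n$ (all spaces are complex). Let $H_n=\mathbb{C}^n$, let $R_N\subset M_N$ be the row operator space on $\ell_2^N$, spanned by the matrices $|1\rangle\langle k|$, $k\le N$, and for an operator space $E$ and $F\in E\otimes B(H_n)$ let $$\|F\|_{E\otimes_{\min}B(H_n)}=\sup_{H,u}\|(u\otimes \mathrm{id})(F)\|_{B(H\otimes H_n)},$$ the supremum being over all Hilbert spaces $H$ and all complete contractions $u:E\to B(H)$. Given $\delta\in(0,\tfrac12)$, constants $C,K$ and $n\in\mathbb{N}$, put $N=\lfloor\delta n\rfloor$ and call linear maps $V:\ell_2^{N}\to\ell_1^n(\ell_\infty^n)$, $V':\ell_1^n(\ell_\infty^n)\to\ell_2^{N}$ a $(\delta,C,K)$-pair for $n$ if $$\|V\|\le C\sqrt{\log n},\qquad \|V'\|\le 1,\qquad V'V=\mathrm{id}_{\ell_2^{N}},\qquad \|V':\ell_1^n(\ell_\infty^n)\to R_{N}\|_{cb}\le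 K.$$ Let $W:\ell_2^{N}\to B(H_n)$ be given by $W(e_k)=|1\rangle\langle k|$, $k=1,\dots,N$. (i) There are $\delta\in(0,\tfrac12)$ and constants $C,K$ such that a $(\delta,C,K)$-pair exists for every $n\in\mathbb{N}$. (ii) For every $C$ there is a constant $A$, depending only on $C$, such that for all $\delta\in(0,\tfrac12)$, all $K$, all $n\in\mathbb{N}$ and every $(\delta,C,K)$-pair $(V,V')$ for $n$, the element $F=(V\otimes W)\big(\sum_{k=1}^{N}e_k\otimes e_k\big)\in\ell_1^n(\ell_\infty^n)\otimes B(H_n)$ satisfies $$\|F\|_{\ell_1^n(\ell_\infty^n)\otimes_{\min}B(H_n)}\le A\sqrt{n\log n}.$$ -/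

import Mathlib

open scoped ENNReal TensorProduct

noncomputable section

/-- A family of (extended) norms, one on each space `M_d(E)` of `d × d` matrices over `E`: the
data by which an operator space structure on `E` is given. -/
abbrev MatrixNorms (E : Type*) : Type _ := (d : ℕ) → Matrix (Fin d) (Fin d) E → ℝ≥0∞

/-- The inequality `‖u : E → G‖_cb ≤ c`, where `E`, `G` carry the matrix norms `νE`, `νG`. -/
def CbNormLe {E G : Type*} [AddCommGroup E] [Module ℂ E] [AddCommGroup G] [Module ℂ G]
    (νE : MatrixNorms E) (νG : MatrixNorms G) (u : E →ₗ[ℂ] G) (c : ℝ≥0∞) : Prop :=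
  ∀ (d : ℕ) (X : Matrix (Fin d) (Fin d) E), νG d (X.map u) ≤ c * νE d X

/-- `u` is a complete contraction. -/
def CompletelyContractive {E G : Type*} [AddCommGroup E] [Module ℂ E] [AddCommGroup G]
    [Module ℂ G] (νE : MatrixNorms E) (νG : MatrixNorms G) (u : E →ₗ[ℂ] G) : Prop :=
  CbNormLe νE νG u 1

/-- A matrix `(T i j)` of operators on `H`, acting on the Hilbert space sum `H ⊕ ⋯ ⊕ H` by
`(T ξ) i = ∑ j, T i j (ξ j)`. -/
def blockOp {H : Type*} [NormedAddCommGroup H] [InnerProductSpace ℂ H] {d : ℕ}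
    (T : Matrix (Fin d) (Fin d) (H →L[ℂ] H)) :
    PiLp 2 (fun _ : Fin d => H) →L[ℂ] PiLp 2 (fun _ : Fin d => H) :=
  ((PiLp.continuousLinearEquiv 2 ℂ (fun _ : Fin d => H)).symm :
      (Fin d → H) →L[ℂ] PiLp 2 (fun _ : Fin d => H)) ∘L
    ContinuousLinearMap.pi (fun i => ∑ j, T i j ∘L ContinuousLinearMap.proj j) ∘L
    (PiLp.continuousLinearEquiv 2 ℂ (fun _ : Fin d => H) :
      PiLp 2 (fun _ : Fin d => H) →L[ℂ] (Fin d → H))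

theorem blockOp_apply {H : Type*} [NormedAddCommGroup H] [InnerProductSpace ℂ H] {d : ℕ}
    (T : Matrix (Fin d) (Fin d) (H →L[ℂ] H)) (ξ : PiLp 2 (fun _ : Fin d => H)) (i : Fin d) :
    blockOp T ξ i = ∑ j, T i j (ξ j) := by
  simp [blockOp]

/-- The operator space `B(H)`: `M_d(B(H))` is normed as `B(H ⊕ ⋯ ⊕ H)`. -/
def bhNorms (H : Type*) [NormedAddCommGroup H] [InnerProductSpace ℂ H] :
    MatrixNorms (H →L[ℂ] H) :=
  fun _ T => ‖blockOp T‖ₑ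

/-- The operator space `ℓ_∞^m`: `M_d(ℓ_∞^m) = ℓ_∞^m(M_d)`, where `M_d = B(ℂ^d)`. -/
def linftyNorms (m : ℕ) : MatrixNorms (Fin m → ℂ) :=
  fun _ X => ⨆ a : Fin m, ‖Matrix.toEuclideanCLM (𝕜 := ℂ) (X.map (fun z => z a))‖ₑ

/-- The Banach space `ℓ_1^n(ℓ_∞^m)`, with norm `z ↦ ∑ x, max a, |z x a|`. -/
abbrev L1Linfty (n m : ℕ) : Type := PiLp 1 (fun _ : Fin n => (Fin m → ℂ))

/-- The map on `ℓ_1^n(ℓ_∞^m)` that is `u x` on the `x`-th summand. -/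
def sumMap {n m : ℕ} {G : Type*} [AddCommGroup G] [Module ℂ G]
    (u : Fin n → ((Fin m → ℂ) →ₗ[ℂ] G)) : L1Linfty n m →ₗ[ℂ] G :=
  ∑ x : Fin n, u x ∘ₗ PiLp.projₗ (𝕜 := ℂ) 1 (fun _ : Fin n => (Fin m → ℂ)) x

/-- The operator space `ℓ_1^n(ℓ_∞^m)`, the `ℓ_1`-direct sum of `n` copies of `ℓ_∞^m`: its matrix
norms are the largest ones for which every map whose restrictions to the summands are complete
contractions into some `B(H)` is itself a complete contraction. (Replacing `H` by a separable
reducing subspace shows that the universe of `H` does not matter.) -/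
def l1LinftyNorms (n m : ℕ) : MatrixNorms (L1Linfty n m) :=
  fun d X => ⨆ (H : Type) (_ : NormedAddCommGroup H) (_ : InnerProductSpace ℂ H)
    (_ : CompleteSpace H) (u : Fin n → ((Fin m → ℂ) →ₗ[ℂ] (H →L[ℂ] H)))
    (_ : ∀ x, CompletelyContractive (linftyNorms m) (bhNorms H) (u x)),
      bhNorms H d (X.map (sumMap u))

/-- The map `v ↦ ∑ k, v k |1⟩⟨k|` from `ℓ_2^N` to `M_n = B(H_n)`, used for `N ≤ n`
(basis vectors are numbered from `0` in the code). -/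
def rowMap (N n : ℕ) : EuclideanSpace ℂ (Fin N) →ₗ[ℂ] Matrix (Fin n) (Fin n) ℂ where
  toFun v := ∑ k : Fin N, v k •
    Matrix.of (fun i j : Fin n => if (i : ℕ) = 0 ∧ (j : ℕ) = (k : ℕ) then (1 : ℂ) else 0)
  map_add' v w := by simp only [PiLp.add_apply, add_smul, Finset.sum_add_distrib]
  map_smul' c v := by
    simp only [PiLp.smul_apply, smul_eq_mul, mul_smul, Finset.smul_sum, RingHom.id_apply]

/-- The row operator space `R_N`: the vector space `ℓ_2^N`, embedded in `M_N = B(ℂ^N)` by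
`e_k ↦ |1⟩⟨k|`. -/
def rowNorms (N : ℕ) : MatrixNorms (EuclideanSpace ℂ (Fin N)) :=
  fun d X => bhNorms (EuclideanSpace ℂ (Fin N)) d
    (X.map (fun v => Matrix.toEuclideanCLM (𝕜 := ℂ) (rowMap N N v)))

/-- The identification of `G ⊗ M_n` with `M_n(G)`, sending `g ⊗ A` to the matrix `(A i j • g)`. -/
def tensorToMatrix (G : Type*) [AddCommGroup G] [Module ℂ G] (n : ℕ) :
    G ⊗[ℂ] Matrix (Fin n) (Fin n) ℂ →ₗ[ℂ] Matrix (Fin n) (Fin n) G :=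
  TensorProduct.lift
    { toFun := fun g =>
        { toFun := fun A => Matrix.of (fun i j => A i j • g)
          map_add' := fun A B => by ext i j; simp [add_smul]
          map_smul' := fun c A => by ext i j; simp [mul_smul] }
      map_add' := fun g h => by ext A i j; simp
      map_smul' := fun c g => by ext A i j : 3; exact smul_comm _ _ _ }

/-- The norm of `E ⊗_min B(H_n)`, `H_n = ℂ^n`: the supremum of `‖(u ⊗ id)(F)‖` over all complete
contractions `u : E → B(H)`, the norm being that of `B(H ⊗ H_n) = M_n(B(H))`. -/
def minNorm {E : Type*} [AddCommGroup E] [Module ℂ E] (νE : MatrixNorms E) {n : ℕ}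
    (F : E ⊗[ℂ] Matrix (Fin n) (Fin n) ℂ) : ℝ≥0∞ :=
  ⨆ (H : Type) (_ : NormedAddCommGroup H) (_ : InnerProductSpace ℂ H) (_ : CompleteSpace H)
    (u : E →ₗ[ℂ] (H →L[ℂ] H)) (_ : CompletelyContractive νE (bhNorms H) u),
      bhNorms H n (tensorToMatrix (H →L[ℂ] H) n (TensorProduct.map u LinearMap.id F))

/-- `V : ℓ_2^N → ℓ_1^n(ℓ_∞^n)` and `V' : ℓ_1^n(ℓ_∞^n) → ℓ_2^N` exhibit `ℓ_2^N` as a complemented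
subspace, with `‖V‖ ≤ C √(log n)`, `‖V'‖ ≤ 1`, `V' V = id` and `‖V' : ℓ_1^n(ℓ_∞^n) → R_N‖_cb ≤ K`. -/
def IsComplementedPair (C K : ℝ) (n N : ℕ)
    (V : EuclideanSpace ℂ (Fin N) →L[ℂ] L1Linfty n n)
    (V' : L1Linfty n n →L[ℂ] EuclideanSpace ℂ (Fin N)) : Prop :=
  ‖V‖ ≤ C * √(Real.log n) ∧ ‖V'‖ ≤ 1 ∧ V' ∘L V = ContinuousLinearMap.id ℂ _ ∧
    CbNormLe (l1LinftyNorms n n) (rowNorms N) V'.toLinearMap (ENNReal.ofReal K)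

/-- The element `F = (V ⊗ W)(∑ k, e_k ⊗ e_k)` of `ℓ_1^n(ℓ_∞^n) ⊗ B(H_n)`, `W e_k = |1⟩⟨k|`. -/
def steeringElement {n N : ℕ} (V : EuclideanSpace ℂ (Fin N) →L[ℂ] L1Linfty n n) :
    L1Linfty n n ⊗[ℂ] Matrix (Fin n) (Fin n) ℂ :=
  TensorProduct.map V.toLinearMap (rowMap N n)
    (∑ k : Fin N, EuclideanSpace.single k (1 : ℂ) ⊗ₜ[ℂ] EuclideanSpace.single k (1 : ℂ))

end

/-! For (i), each of the `n` summands carries the first `N` columns of the Fourier matrix, with a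
sign ε_k(x) attached to column `k` in summand `x`: `B x a k = z ^ (a * k) * ε_k(x)`. Take `V =
embedMap B`, which is `n⁻¹ B x` in summand `x`, and let `V'` add up the maps `n⁻¹ (B x)*`. Whatever
the signs, the columns of `B x` are orthogonal with squared norm `n`; this alone gives `V' V = id`,
`‖V'‖ ≤ 1` and complete contractivity into `R_N` (`completelyContractive_rowCLM_fiberProj`).

The signs matter only for `‖V‖`. An ℓ_1(ℓ_∞) norm is attained by choosing one coordinate and one
phase in each summand, so up to real and imaginary parts there are `(2n)^n` functionals to control.
By Cauchy–Schwarz each is governed by a square function of random sign sums, whose exponential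
moments are bounded; a union bound costs `log ((2n)^n)`, of order `n log n`, whence `‖V‖ ≤ 10 √(log
n)` (`exists_signs`, `norm_embedMap_le`).

For (ii), a complete contraction `u` sends `F` to a block matrix supported in its first row, with
entries `u (V e_k)` of norm at most `‖V‖`. Such a row has norm at most `√n ‖V‖`, so `A = C` works.
-/

/-! ### Random signs and orthogonality of the Fourier columns. -/

/-- Averaging over one sign multiplies a Gaussian-type exponential by at most a controlled
factor. -/
theorem exp_add_exp_sign_le (s c : ℂ) (hc : ‖c‖ = 1) {l : ℝ} :
    Real.exp (l * ‖s + c‖ ^ 2) + Real.exp (l * ‖s - c‖ ^ 2) ≤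
      2 * (Real.exp l * Real.exp (l * (1 + 2 * l) * ‖s‖ ^ 2)) := by
  have h1 := norm_add_sq_real s c
  have h2 := norm_sub_sq_real s c
  have hi : (inner ℝ s c) ^ 2 ≤ ‖s‖ ^ 2 := by
    have := abs_real_inner_le_norm s c
    rw [hc, mul_one] at this
    exact sq_le_sq' (abs_le.1 this).1 (abs_le.1 this).2
  -- Expanding the squares leaves cross terms `±2l⟨s, c⟩`, which average to a hyperbolic cosine.
  have h3 := Real.cosh_le_exp_half_sq (2 * l * inner ℝ s c)
  rw [Real.cosh_eq] at h3
  have e1 : Real.exp (l * ‖s + c‖ ^ 2) =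
      Real.exp (l * ‖s‖ ^ 2 + l) * Real.exp (2 * l * inner ℝ s c) := by
    rw [← Real.exp_add, h1, hc]; ring_nf
  have e2 : Real.exp (l * ‖s - c‖ ^ 2) =
      Real.exp (l * ‖s‖ ^ 2 + l) * Real.exp (-(2 * l * inner ℝ s c)) := by
    rw [← Real.exp_add, h2, hc]; ring_nf
  have h4 : Real.exp ((2 * l * inner ℝ s c) ^ 2 / 2) ≤ Real.exp (2 * l ^ 2 * ‖s‖ ^ 2) := by
    apply Real.exp_le_exp.2
    nlinarith [mul_le_mul_of_nonneg_left hi (sq_nonneg l)]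
  have e3 : Real.exp l * Real.exp (l * (1 + 2 * l) * ‖s‖ ^ 2) =
      Real.exp (l * ‖s‖ ^ 2 + l) * Real.exp (2 * l ^ 2 * ‖s‖ ^ 2) := by
    rw [← Real.exp_add, ← Real.exp_add]; ring_nf
  rw [e1, e2, e3, ← mul_add, mul_left_comm]
  gcongr
  linarith

/-- The sign `±1` attached to a Boolean. -/
def boolSign (b : Bool) : ℂ := if b then 1 else -1

theorem norm_boolSign (b : Bool) : ‖boolSign b‖ = 1 := by
  cases b <;> simp [boolSign]

theorem star_boolSign_mul_self (b : Bool) : star (boolSign b) * boolSign b = 1 := by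
  cases b <;> simp [boolSign]

/-- Removing one sign turns the exponent `l` into `l(1 + 2l)`, at the price of a factor `exp l ≤ exp
(1/t)`. The exponents `1/(t + 4m)` absorb this, since `l(1 + 2l) ≤ l/(1 - 4l)` and `l/(1 - 4l)` is
the exponent for one sign fewer. -/
theorem sum_exp_norm_sq_le {t : ℝ} (ht : 0 < t) (m : ℕ) (c : Fin m → ℂ) (hc : ∀ x, ‖c x‖ = 1) :
    ∑ e : Fin m → Bool, Real.exp ((t + 4 * m)⁻¹ * ‖∑ x, c x * boolSign (e x)‖ ^ 2) ≤
      2 ^ m * Real.exp (m / t) := by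
  induction m with
  | zero => simp
  | succ m ih =>
    have hp : (0 : ℝ) < t + 4 * m := by positivity
    have hp' : (0 : ℝ) < t + 4 * (m + 1 : ℕ) := by positivity
    set l : ℝ := (t + 4 * (m + 1 : ℕ))⁻¹ with hl
    have hl0 : 0 < l := inv_pos.2 hp'
    have hlt : l ≤ 1 / t := by
      rw [hl, one_div]
      apply inv_anti₀ ht
      have : (0 : ℝ) ≤ (m + 1 : ℕ) := by positivity
      linarith
    have hll : l * (1 + 2 * l) ≤ (t + 4 * m)⁻¹ := by
      have h1 : t + 4 * m = l⁻¹ - 4 := by rw [hl, inv_inv]; push_cast; ring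
      rw [h1] at hp ⊢
      have h2 : 4 * l < 1 := by
        have := mul_lt_mul_of_pos_right (sub_pos.1 hp) hl0
        rwa [inv_mul_cancel₀ hl0.ne'] at this
      rw [← one_div, le_div_iff₀ hp]
      have : l * (1 + 2 * l) * (l⁻¹ - 4) = (1 + 2 * l) * (1 - 4 * l) := by field_simp
      rw [this]
      nlinarith
    rw [← (Fin.consEquiv (fun _ : Fin (m + 1) => Bool)).sum_comp, Fintype.sum_prod_type_right]
    have step : ∀ e : Fin m → Bool,
        ∑ b : Bool, Real.exp (l * ‖∑ x, c x *
          boolSign ((Fin.consEquiv (fun _ : Fin (m + 1) => Bool)) (b, e) x)‖ ^ 2) ≤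
        (2 * Real.exp (1 / t)) *
          Real.exp ((t + 4 * m)⁻¹ * ‖∑ x, c x.succ * boolSign (e x)‖ ^ 2) := by
      intro e
      have := exp_add_exp_sign_le (∑ x, c x.succ * boolSign (e x)) (c 0) (hc 0) (l := l)
      simp only [Fintype.sum_bool, Fin.sum_univ_succ, Fin.consEquiv_apply, Fin.cons_zero,
        Fin.cons_succ, boolSign, if_true, Bool.false_eq_true, if_false, mul_one, mul_neg_one]
        at this ⊢
      rw [add_comm (c 0), neg_add_eq_sub]
      refine this.trans ?_
      rw [mul_assoc 2]
      gcongr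
    refine (Finset.sum_le_sum fun e _ => step e).trans ?_
    rw [← Finset.mul_sum]
    refine (mul_le_mul_of_nonneg_left (ih (fun x => c x.succ) fun x => hc _) (by positivity)).trans
      (le_of_eq ?_)
    have : Real.exp ((m + 1 : ℕ) / t) = Real.exp (1 / t) * Real.exp (m / t) := by
      rw [← Real.exp_add]; push_cast; ring_nf
    rw [this]; ring

/-- Random signs: for a finite family of arrays of unimodular numbers there is one array of signs
for which all the row sums are simultaneously of order `√m`, in mean square, up to a logarithm of
the size of the family. -/
theorem exists_signs {ι : Type*} [Fintype ι] [Nonempty ι] (m N : ℕ) (hm : 0 < m)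
    (c : ι → Fin m → Fin N → ℂ) (hc : ∀ i x k, ‖c i x k‖ = 1) :
    ∃ e : Fin N → Fin m → Bool, ∀ i,
      ∑ k, ‖∑ x, c i x k * boolSign (e k x)‖ ^ 2 ≤
        8 * m * (Real.log (Fintype.card ι) + N / 4) := by
  have hm' : (0 : ℝ) < m := by exact_mod_cast hm
  -- The choice `t = 4m` makes each exponential moment at most `exp (1/4)`, independently of `m`.
  set l : ℝ := (4 * m + 4 * m : ℝ)⁻¹ with hl
  let f : ι → Fin N → (Fin m → Bool) → ℝ := fun i k e =>
    Real.exp (l * ‖∑ x, c i x k * boolSign (e x)‖ ^ 2)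
  have hf : ∀ i k, ∑ e, f i k e ≤ 2 ^ m * Real.exp (1 / 4) := by
    intro i k
    refine (sum_exp_norm_sq_le (t := 4 * m) (by positivity) m (fun x => c i x k)
      fun x => hc i x k).trans (le_of_eq ?_)
    congr 2
    field_simp
  have htot : ∑ e : Fin N → Fin m → Bool, ∑ i, ∏ k, f i k (e k) ≤
      ∑ _e : Fin N → Fin m → Bool, (Fintype.card ι : ℝ) * Real.exp (N / 4) := by
    rw [Finset.sum_comm]
    have : ∀ i, ∑ e : Fin N → Fin m → Bool, ∏ k, f i k (e k) ≤
        (2 ^ m * Real.exp (1 / 4)) ^ N := by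
      intro i
      -- Signs for different `k` are independent, so the sum of products factorises.
      rw [← Fintype.piFinset_univ, ← Finset.prod_univ_sum]
      refine (Finset.prod_le_prod (fun k _ => Finset.sum_nonneg fun e _ => (Real.exp_pos _).le)
        fun k _ => hf i k).trans (by simp)
    refine (Finset.sum_le_sum fun i _ => this i).trans (le_of_eq ?_)
    simp only [Finset.sum_const, Finset.card_univ, nsmul_eq_mul, Fintype.card_fun,
      Fintype.card_fin, Fintype.card_bool]
    rw [mul_pow, ← Real.exp_nat_mul]
    push_cast
    ring_nf
  -- Some choice of signs does no worse than average; every term being positive, it then controls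
  -- all `i` at once.
  obtain ⟨e, -, he⟩ := Finset.exists_le_of_sum_le Finset.univ_nonempty htot
  refine ⟨e, fun i => ?_⟩
  have h1 : ∏ k, f i k (e k) ≤ (Fintype.card ι : ℝ) * Real.exp (N / 4) :=
    (Finset.single_le_sum (f := fun i => ∏ k, f i k (e k))
      (fun i _ => Finset.prod_nonneg fun k _ => (Real.exp_pos _).le) (Finset.mem_univ i)).trans he
  have hcard : (0 : ℝ) < Fintype.card ι := by exact_mod_cast Fintype.card_pos
  rw [← Real.exp_sum, ← Finset.mul_sum] at h1
  have h2 := Real.log_le_log (Real.exp_pos _) h1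
  rw [Real.log_exp, Real.log_mul hcard.ne' (Real.exp_ne_zero _), Real.log_exp] at h2
  have h3 : l = (8 * m : ℝ)⁻¹ := by rw [hl]; ring_nf
  rw [h3, inv_mul_le_iff₀ (by positivity)] at h2
  exact h2

/-- The Fourier matrix has orthogonal columns. -/
theorem sum_star_fourier_mul {n : ℕ} (hn : 0 < n) {z : ℂ} (hz : IsPrimitiveRoot z n)
    {k l : ℕ} (hk : k < n) (hl : l < n) :
    ∑ a : Fin n, star (z ^ ((a : ℕ) * k)) * z ^ ((a : ℕ) * l) = if k = l then (n : ℂ) else 0 := by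
  have hz1 : ‖z‖ = 1 := hz.norm'_eq_one hn.ne'
  have hz0 : z ≠ 0 := hz.ne_zero hn.ne'
  have hstar : star z = z⁻¹ := (Complex.inv_eq_conj hz1).symm
  have key : ∀ a : ℕ, star (z ^ (a * k)) * z ^ (a * l) = (z ^ l / z ^ k) ^ a := by
    intro a
    rw [star_pow, hstar, div_pow, ← pow_mul, ← pow_mul, inv_pow, mul_comm a k, mul_comm a l,
      div_eq_mul_inv, mul_comm]
  simp only [key]
  rw [Fin.sum_univ_eq_sum_range (fun a => (z ^ l / z ^ k) ^ a)]
  split_ifs with h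
  · subst h
    simp [div_self (pow_ne_zero k hz0)]
  · have h1 : z ^ l / z ^ k ≠ 1 := by
      intro h1
      rw [div_eq_one_iff_eq (pow_ne_zero k hz0)] at h1
      exact h (hz.pow_inj hl hk h1).symm
    rw [geom_sum_eq h1, div_pow, ← pow_mul, ← pow_mul, mul_comm l, mul_comm k, pow_mul, pow_mul,
      hz.pow_eq_one]
    simp

/-! ### The upper bound for the minimal tensor norm. -/

theorem norm_blockOp_le_of_row {H : Type*} [NormedAddCommGroup H] [InnerProductSpace ℂ H] {d : ℕ}
    (M : Matrix (Fin d) (Fin d) (H →L[ℂ] H)) {D : ℝ} (hD : 0 ≤ D)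
    (hM : ∀ i j, ‖M i j‖ ≤ if (i : ℕ) = 0 then D else 0) :
    ‖blockOp M‖ ≤ √d * D := by
  refine ContinuousLinearMap.opNorm_le_bound _ (by positivity) fun ξ => ?_
  refine abs_le_of_sq_le_sq' ?_ (by positivity) |>.2
  rw [PiLp.norm_sq_eq_of_L2, mul_pow, mul_pow, Real.sq_sqrt (Nat.cast_nonneg d),
    PiLp.norm_sq_eq_of_L2]
  simp only [blockOp_apply]
  have hrow : ∀ i, ‖∑ j, M i j (ξ j)‖ ≤ if (i : ℕ) = 0 then ∑ j, D * ‖ξ j‖ else 0 := by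
    intro i
    have h1 : ‖∑ j, M i j (ξ j)‖ ≤ ∑ j, (if (i : ℕ) = 0 then D else 0) * ‖ξ j‖ :=
      (norm_sum_le _ _).trans (Finset.sum_le_sum fun j _ => (M i j).le_of_opNorm_le (hM i j) _)
    refine h1.trans (le_of_eq ?_)
    split_ifs <;> simp
  have hsq : (∑ j, D * ‖ξ j‖) ^ 2 ≤ d * D ^ 2 * ∑ j, ‖ξ j‖ ^ 2 := by
    have := sq_sum_le_card_mul_sum_sq (s := Finset.univ) (f := fun j => ‖ξ j‖)
    rw [← Finset.mul_sum, mul_pow]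
    rw [Finset.card_univ, Fintype.card_fin] at this
    nlinarith [mul_le_mul_of_nonneg_left this (sq_nonneg D)]
  cases d with
  | zero => simp
  | succ d =>
    rw [Fin.sum_univ_succ]
    have h0 : ‖∑ j, M 0 j (ξ j)‖ ≤ ∑ j, D * ‖ξ j‖ := by simpa using hrow 0
    have hs : ∀ i : Fin d, ‖∑ j, M i.succ j (ξ j)‖ ^ 2 = 0 := by
      intro i
      have := hrow i.succ
      simp only [Fin.val_succ, Nat.succ_ne_zero, if_false] at this
      rw [le_antisymm this (norm_nonneg _)]
      simp
    rw [Finset.sum_eq_zero fun i _ => hs i, add_zero]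
    exact (pow_le_pow_left₀ (norm_nonneg _) h0 2).trans hsq

theorem bhNorms_one {H : Type*} [NormedAddCommGroup H] [InnerProductSpace ℂ H]
    (M : Matrix (Fin 1) (Fin 1) (H →L[ℂ] H)) : bhNorms H 1 M = ‖M 0 0‖ₑ := by
  have hn : ∀ ξ : PiLp 2 (fun _ : Fin 1 => H), ‖ξ‖ = ‖ξ 0‖ := fun ξ => by
    rw [PiLp.norm_eq_of_L2]; simp
  have h : ‖blockOp M‖ = ‖M 0 0‖ := by
    apply le_antisymm
    · refine ContinuousLinearMap.opNorm_le_bound _ (norm_nonneg _) fun ξ => ?_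
      rw [hn, hn, blockOp_apply]
      simpa using (M 0 0).le_opNorm (ξ 0)
    · refine ContinuousLinearMap.opNorm_le_bound _ (norm_nonneg (blockOp M)) fun v => ?_
      have := (blockOp M).le_opNorm (WithLp.toLp 2 fun _ => v)
      rw [hn, hn, blockOp_apply] at this
      simpa using this
  rw [bhNorms, ← ofReal_norm, ← ofReal_norm, h]

theorem linftyNorms_one_le {m : ℕ} (y : Fin m → ℂ) :
    linftyNorms m 1 (Matrix.of fun _ _ => y) ≤ ‖y‖ₑ := by
  refine iSup_le fun a => ?_
  refine le_trans ?_ (enorm_le_iff_norm_le.2 (norm_le_pi_norm y a))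
  refine enorm_le_iff_norm_le.2 ?_
  refine ContinuousLinearMap.opNorm_le_bound _ (norm_nonneg _) fun ξ => ?_
  rw [EuclideanSpace.norm_eq, EuclideanSpace.norm_eq]
  simp [Matrix.mulVec, dotProduct, Real.sqrt_sq (mul_nonneg (norm_nonneg _) (norm_nonneg _))]

theorem l1LinftyNorms_one_le {n m : ℕ} (z : L1Linfty n m) :
    l1LinftyNorms n m 1 (Matrix.of fun _ _ => z) ≤ ‖z‖ₑ := by
  refine iSup_le fun H => iSup_le fun _ => iSup_le fun _ => iSup_le fun _ => iSup_le fun u =>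
    iSup_le fun hu => ?_
  rw [bhNorms_one]
  have h1 : ∀ x, ‖u x (z x)‖ ≤ ‖z x‖ := by
    intro x
    have h := hu x 1 (Matrix.of fun _ _ => z x)
    rw [bhNorms_one, one_mul] at h
    exact enorm_le_iff_norm_le.1 (h.trans (linftyNorms_one_le _))
  refine enorm_le_iff_norm_le.2 ?_
  rw [PiLp.norm_eq_of_L1]
  simp only [Matrix.map_apply, Matrix.of_apply, sumMap, LinearMap.sum_apply,
    LinearMap.comp_apply, PiLp.projₗ_apply]
  exact (norm_sum_le _ _).trans (Finset.sum_le_sum fun x _ => h1 x)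

/-- Matrix size `1` is the only level of complete contractivity that the bound in (ii) needs. -/
theorem CompletelyContractive.norm_le {n m : ℕ} {H : Type*} [NormedAddCommGroup H]
    [InnerProductSpace ℂ H] {u : L1Linfty n m →ₗ[ℂ] (H →L[ℂ] H)}
    (hu : CompletelyContractive (l1LinftyNorms n m) (bhNorms H) u) (z : L1Linfty n m) :
    ‖u z‖ ≤ ‖z‖ := by
  have h := hu 1 (Matrix.of fun _ _ => z)
  rw [bhNorms_one, one_mul] at h
  exact enorm_le_iff_norm_le.1 (h.trans (l1LinftyNorms_one_le _))

theorem rowMap_single (N n : ℕ) (k : Fin N) (i j : Fin n) :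
    rowMap N n (EuclideanSpace.single k 1) i j =
      if (i : ℕ) = 0 ∧ (j : ℕ) = (k : ℕ) then (1 : ℂ) else 0 := by
  simp only [rowMap, LinearMap.coe_mk, AddHom.coe_mk, Matrix.sum_apply]
  rw [Finset.sum_eq_single k] <;> simp +contextual

theorem tensorToMatrix_steeringElement {n N : ℕ} {G : Type*} [AddCommGroup G] [Module ℂ G]
    (V : EuclideanSpace ℂ (Fin N) →L[ℂ] L1Linfty n n) (u : L1Linfty n n →ₗ[ℂ] G) (i j : Fin n) :
    tensorToMatrix G n (TensorProduct.map u LinearMap.id (steeringElement V)) i j =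
      ∑ k : Fin N, (if (i : ℕ) = 0 ∧ (j : ℕ) = (k : ℕ) then (1 : ℂ) else 0) •
        u (V (EuclideanSpace.single k 1)) := by
  simp [steeringElement, tensorToMatrix, Matrix.sum_apply, rowMap_single]

theorem minNorm_steeringElement_le {n N : ℕ}
    (V : EuclideanSpace ℂ (Fin N) →L[ℂ] L1Linfty n n) :
    minNorm (l1LinftyNorms n n) (steeringElement V) ≤ ENNReal.ofReal (√n * ‖V‖) := by
  refine iSup_le fun H => iSup_le fun _ => iSup_le fun _ => iSup_le fun _ => iSup_le fun u =>
    iSup_le fun hu => ?_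
  rw [bhNorms, ← ofReal_norm]
  refine ENNReal.ofReal_le_ofReal (norm_blockOp_le_of_row _ (norm_nonneg V) fun i j => ?_)
  rw [tensorToMatrix_steeringElement]
  split_ifs with hi
  · by_cases hj : (j : ℕ) < N
    · rw [Finset.sum_eq_single (⟨j, hj⟩ : Fin N)]
      · simp only [hi, true_and, if_true, one_smul]
        refine (hu.norm_le _).trans ((V.le_opNorm _).trans (by simp))
      · intro k _ hk
        rw [if_neg, zero_smul]
        rintro ⟨-, h⟩
        exact hk (Fin.ext h.symm)
      · simp
    · rw [Finset.sum_eq_zero]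
      · simp
      · intro k _
        rw [if_neg, zero_smul]
        rintro ⟨-, h⟩
        exact hj (h ▸ k.2)
  · simp [hi]

/-! ### The embedding and the projection given by orthogonal columns. -/

theorem sum_norm_sq_of_orthogonal {α κ : Type*} [Fintype α] [Fintype κ] [DecidableEq κ] {q : ℝ}
    {b : α → κ → ℂ} (hb : ∀ k l, ∑ a, star (b a k) * b a l = if k = l then (q : ℂ) else 0)
    (v : κ → ℂ) : ∑ a, ‖∑ k, b a k * v k‖ ^ 2 = q * ∑ k, ‖v k‖ ^ 2 := by
  have hs : ∀ w : ℂ, ((‖w‖ ^ 2 : ℝ) : ℂ) = star w * w := fun w => by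
    rw [RCLike.star_def, mul_comm, RCLike.mul_conj]; simp
  apply Complex.ofReal_injective
  rw [Complex.ofReal_mul, Complex.ofReal_sum, Complex.ofReal_sum]
  simp only [hs, star_sum, star_mul', Finset.sum_mul_sum]
  rw [Finset.sum_comm]
  calc ∑ k, ∑ a, ∑ l, star (b a k) * star (v k) * (b a l * v l)
      = ∑ k, ∑ l, star (v k) * v l * ∑ a, star (b a k) * b a l := by
        refine Finset.sum_congr rfl fun k _ => ?_
        rw [Finset.sum_comm]
        refine Finset.sum_congr rfl fun l _ => ?_
        rw [Finset.mul_sum]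
        exact Finset.sum_congr rfl fun a _ => by ring
    _ = _ := by
        rw [Finset.mul_sum]
        refine Finset.sum_congr rfl fun k _ => ?_
        simp only [hb, mul_ite, mul_zero, Finset.sum_ite_eq, Finset.mem_univ, if_true]
        ring

/-- The map `v ↦ (n⁻¹ ∑ k, B x a k v k)_{x, a}`. -/
noncomputable def embedMap {n N : ℕ} (B : Fin n → Fin n → Fin N → ℂ) :
    EuclideanSpace ℂ (Fin N) →ₗ[ℂ] L1Linfty n n where
  toFun v := WithLp.toLp 1 fun x a => (n : ℂ)⁻¹ * ∑ k, B x a k * v k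
  map_add' v w := by
    ext x a; simp [mul_add, Finset.sum_add_distrib]
  map_smul' c v := by
    ext x a
    simp only [PiLp.smul_apply, Pi.smul_apply, smul_eq_mul, RingHom.id_apply, Finset.mul_sum]
    exact Finset.sum_congr rfl fun k _ => by ring

/-- The map `y ↦ (n⁻¹ ∑ a, conj (b a k) y a)_k`. -/
noncomputable def fiberProj {n N : ℕ} (b : Fin n → Fin N → ℂ) :
    (Fin n → ℂ) →ₗ[ℂ] EuclideanSpace ℂ (Fin N) where
  toFun y := WithLp.toLp 2 fun k => (n : ℂ)⁻¹ * ∑ a, star (b a k) * y a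
  map_add' v w := by
    ext k; simp [mul_add, Finset.sum_add_distrib]
  map_smul' c v := by
    ext k
    simp only [PiLp.smul_apply, Pi.smul_apply, smul_eq_mul, RingHom.id_apply, Finset.mul_sum]
    exact Finset.sum_congr rfl fun a _ => by ring

theorem embedMap_apply {n N : ℕ} (B : Fin n → Fin n → Fin N → ℂ) (v : EuclideanSpace ℂ (Fin N))
    (x a : Fin n) : embedMap B v x a = (n : ℂ)⁻¹ * ∑ k, B x a k * v k := rfl

theorem fiberProj_apply {n N : ℕ} (b : Fin n → Fin N → ℂ) (y : Fin n → ℂ) (k : Fin N) :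
    fiberProj b y k = (n : ℂ)⁻¹ * ∑ a, star (b a k) * y a := rfl

theorem sumMap_apply {n m : ℕ} {G : Type*} [AddCommGroup G] [Module ℂ G]
    (u : Fin n → ((Fin m → ℂ) →ₗ[ℂ] G)) (z : L1Linfty n m) :
    sumMap u z = ∑ x, u x (z x) := by
  simp [sumMap]

/-- The isometric embedding of `R_N` into `B(ℂ^N)`. -/
noncomputable def rowCLM (N : ℕ) :
    EuclideanSpace ℂ (Fin N) →ₗ[ℂ] (EuclideanSpace ℂ (Fin N) →L[ℂ] EuclideanSpace ℂ (Fin N)) :=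
  (Matrix.toEuclideanCLM (n := Fin N) (𝕜 := ℂ)).toAlgEquiv.toLinearMap ∘ₗ rowMap N N

theorem rowCLM_apply (N : ℕ) (v w : EuclideanSpace ℂ (Fin N)) (i : Fin N) :
    rowCLM N v w i = if (i : ℕ) = 0 then ∑ k, v k * w k else 0 := by
  have h : rowCLM N v w i = ∑ j, rowMap N N v i j * w j := rfl
  have h2 : ∀ j, rowMap N N v i j = if (i : ℕ) = 0 then v j else 0 := by
    intro j
    simp only [rowMap, LinearMap.coe_mk, AddHom.coe_mk, Matrix.sum_apply]
    rw [Finset.sum_eq_single j]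
    · simp
    · intro k _ hk
      simp [Fin.val_inj, hk.symm]
    · simp
  rw [h]
  simp only [h2]
  split_ifs <;> simp

theorem sum_norm_blockOp_rowCLM_le {d N : ℕ} (w : Matrix (Fin d) (Fin d) (EuclideanSpace ℂ (Fin N)))
    (ξ : PiLp 2 (fun _ : Fin d => EuclideanSpace ℂ (Fin N))) :
    ‖blockOp (w.map (rowCLM N)) ξ‖ ^ 2 ≤ ∑ i, ‖∑ j, ∑ k, w i j k * ξ j k‖ ^ 2 := by
  rw [PiLp.norm_sq_eq_of_L2]
  refine Finset.sum_le_sum fun i _ => ?_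
  rw [blockOp_apply, EuclideanSpace.norm_sq_eq]
  have h : ∀ p : Fin N, (∑ j, (w.map (rowCLM N)) i j (ξ j)) p =
      if (p : ℕ) = 0 then ∑ j, ∑ k, w i j k * ξ j k else 0 := by
    intro p
    simp only [WithLp.ofLp_sum, Finset.sum_apply, Matrix.map_apply, rowCLM_apply]
    split_ifs <;> simp
  simp only [h]
  cases N with
  | zero => simp
  | succ N => simp [Fin.sum_univ_succ]

theorem norm_mulVec_le_linftyNorms {m d : ℕ} (X : Matrix (Fin d) (Fin d) (Fin m → ℂ))
    (s : ℝ) (hs : linftyNorms m d X ≤ ENNReal.ofReal s) (hs0 : 0 ≤ s) (a : Fin m)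
    (η : Fin d → ℂ) :
    ∑ i, ‖∑ j, X i j a * η j‖ ^ 2 ≤ s ^ 2 * ∑ j, ‖η j‖ ^ 2 := by
  have h1 : ‖Matrix.toEuclideanCLM (𝕜 := ℂ) (X.map (fun z => z a))‖ ≤ s := by
    have := (le_iSup (fun a : Fin m =>
      ‖Matrix.toEuclideanCLM (𝕜 := ℂ) (X.map (fun z => z a))‖ₑ) a).trans hs
    rw [← ofReal_norm] at this
    exact (ENNReal.ofReal_le_ofReal_iff hs0).1 this
  have h2 := ContinuousLinearMap.le_of_opNorm_le _ h1 (WithLp.toLp 2 η)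
  have h3 := pow_le_pow_left₀ (norm_nonneg _) h2 2
  rw [mul_pow, EuclideanSpace.norm_sq_eq, EuclideanSpace.norm_sq_eq] at h3
  exact h3

/-- The map compresses the diagonal representation of ℓ_∞^n: `y` goes to the row `n⁻¹ 1ᵀ D_y b̄`,
where `b̄/√n` is an isometry and `1ᵀ/√n` is a contraction. The proof spells this out with vectors.
-/
theorem completelyContractive_rowCLM_fiberProj {n N : ℕ} {b : Fin n → Fin N → ℂ}
    (hb : ∀ k l, ∑ a, star (b a k) * b a l = if k = l then ((n : ℝ) : ℂ) else 0) :
    CompletelyContractive (linftyNorms n) (bhNorms (EuclideanSpace ℂ (Fin N)))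
      (rowCLM N ∘ₗ fiberProj b) := by
  intro d X
  rw [one_mul]
  have hfin : linftyNorms n d X ≠ ⊤ := by
    refine ne_of_lt (lt_of_le_of_lt (iSup_le fun a =>
      Finset.single_le_sum (f := fun a : Fin n =>
        ‖Matrix.toEuclideanCLM (𝕜 := ℂ) (X.map (fun z => z a))‖ₑ) (fun _ _ => zero_le)
        (Finset.mem_univ a)) ?_)
    exact ENNReal.sum_lt_top.2 fun a _ => enorm_lt_top
  set s := (linftyNorms n d X).toReal with hs
  have hs' : linftyNorms n d X = ENNReal.ofReal s := (ENNReal.ofReal_toReal hfin).symm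
  have hs0 : 0 ≤ s := ENNReal.toReal_nonneg
  rw [hs', bhNorms, ← ofReal_norm]
  refine ENNReal.ofReal_le_ofReal (ContinuousLinearMap.opNorm_le_bound _ hs0 fun ξ => ?_)
  refine abs_le_of_sq_le_sq' ?_ (by positivity) |>.2
  have hmap : X.map (rowCLM N ∘ₗ fiberProj b) = (X.map (fiberProj b)).map (rowCLM N) := by
    ext1; rfl
  rw [hmap]
  refine (sum_norm_blockOp_rowCLM_le _ ξ).trans ?_
  -- `η a` is the `a`-th component of `b̄ ξ`; the matrix `X(a)` acts on it separately for each `a`.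
  let η : Fin n → Fin d → ℂ := fun a j => ∑ k, star (b a k) * ξ j k
  have hη : ∀ j, ∑ a, ‖η a j‖ ^ 2 = n * ‖ξ j‖ ^ 2 := by
    intro j
    rw [EuclideanSpace.norm_sq_eq]
    have := sum_norm_sq_of_orthogonal hb (fun k => star (ξ j k))
    simp only [norm_star] at this
    rw [← this]
    refine Finset.sum_congr rfl fun a _ => ?_
    rw [← norm_star (∑ k, b a k * star (ξ j k)), star_sum]
    simp [η]
  have hentry : ∀ i, ∑ j, ∑ k, (X.map (fiberProj b)) i j k * ξ j k =
      (n : ℂ)⁻¹ * ∑ a, ∑ j, X i j a * η a j := by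
    intro i
    simp only [Matrix.map_apply, fiberProj_apply, η, Finset.mul_sum, Finset.sum_mul]
    rw [Finset.sum_comm' (t' := Finset.univ) (s' := fun _ => Finset.univ) (by simp)]
    rw [Finset.sum_comm]
    conv_rhs => rw [Finset.sum_comm]
    refine Finset.sum_congr rfl fun j _ => ?_
    rw [Finset.sum_comm]
    exact Finset.sum_congr rfl fun a _ => Finset.sum_congr rfl fun k _ => by ring
  rcases Nat.eq_zero_or_pos n with hn | hn
  · subst hn
    simp only [hentry]
    simp
    positivity
  have hn' : (0 : ℝ) < n := by exact_mod_cast hn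
  have hi : ∀ i, ‖∑ j, ∑ k, (X.map (fiberProj b)) i j k * ξ j k‖ ^ 2 ≤
      (n : ℝ)⁻¹ * ∑ a, ‖∑ j, X i j a * η a j‖ ^ 2 := by
    intro i
    rw [hentry, norm_mul, mul_pow, norm_inv, RCLike.norm_natCast]
    -- Cauchy–Schwarz over `a`; this factor `n` and the one in `hη` cancel the two factors `n⁻¹`.
    have h1 : ‖∑ a, ∑ j, X i j a * η a j‖ ^ 2 ≤ n * ∑ a, ‖∑ j, X i j a * η a j‖ ^ 2 := by
      have := sq_sum_le_card_mul_sum_sq (s := Finset.univ) (f := fun a => ‖∑ j, X i j a * η a j‖)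
      rw [Finset.card_univ, Fintype.card_fin] at this
      exact (pow_le_pow_left₀ (norm_nonneg _) (norm_sum_le _ _) 2).trans this
    calc _ ≤ ((n : ℝ)⁻¹) ^ 2 * (n * ∑ a, ‖∑ j, X i j a * η a j‖ ^ 2) := by gcongr
      _ = _ := by field_simp
  calc _ ≤ ∑ i, (n : ℝ)⁻¹ * ∑ a, ‖∑ j, X i j a * η a j‖ ^ 2 := Finset.sum_le_sum fun i _ => hi i
    _ = (n : ℝ)⁻¹ * ∑ a, ∑ i, ‖∑ j, X i j a * η a j‖ ^ 2 := by
      rw [← Finset.mul_sum, Finset.sum_comm]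
    _ ≤ (n : ℝ)⁻¹ * ∑ a, s ^ 2 * ∑ j, ‖η a j‖ ^ 2 := by
      gcongr with a
      exact norm_mulVec_le_linftyNorms X s hs'.le hs0 a (η a)
    _ = (n : ℝ)⁻¹ * (s ^ 2 * ∑ j, ∑ a, ‖η a j‖ ^ 2) := by
      rw [← Finset.mul_sum, Finset.sum_comm]
    _ = (s * ‖ξ‖) ^ 2 := by
      simp only [hη]
      rw [← Finset.mul_sum, mul_pow, PiLp.norm_sq_eq_of_L2]
      field_simp

/-- The map `ℓ_1^n(ℓ_∞^n) → R_N` is completely contractive. -/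
theorem cbNormLe_sumMap_fiberProj {n N : ℕ} {B : Fin n → Fin n → Fin N → ℂ}
    (hB : ∀ x k l, ∑ a, star (B x a k) * B x a l = if k = l then ((n : ℝ) : ℂ) else 0) :
    CbNormLe (l1LinftyNorms n n) (rowNorms N) (sumMap fun x => fiberProj (B x)) 1 := by
  intro d X
  rw [one_mul]
  have h : rowNorms N d (X.map (sumMap fun x => fiberProj (B x))) =
      bhNorms (EuclideanSpace ℂ (Fin N)) d
        (X.map (sumMap fun x => rowCLM N ∘ₗ fiberProj (B x))) := by
    have hmap : (X.map (sumMap fun x => fiberProj (B x))).map (rowCLM N) =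
        X.map (sumMap fun x => rowCLM N ∘ₗ fiberProj (B x)) := by
      ext1 i j
      simp only [Matrix.map_apply, sumMap_apply, map_sum, LinearMap.comp_apply]
    rw [← hmap]
    rfl
  rw [h]
  exact le_iSup_of_le (EuclideanSpace ℂ (Fin N)) <| le_iSup_of_le inferInstance <|
    le_iSup_of_le inferInstance <| le_iSup_of_le inferInstance <|
    le_iSup_of_le (fun x => rowCLM N ∘ₗ fiberProj (B x)) <|
    le_iSup_of_le (fun x => completelyContractive_rowCLM_fiberProj (hB x)) le_rfl

/-- By duality: pairing `w = fiberProj b y` with itself gives `‖w‖² ≤ n⁻¹ ‖y‖_∞ ‖b w‖_1`, and `‖b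
w‖_1 ≤ √n ‖b w‖_2 = n ‖w‖`. -/
theorem norm_fiberProj_le {n N : ℕ} {b : Fin n → Fin N → ℂ}
    (hb : ∀ k l, ∑ a, star (b a k) * b a l = if k = l then ((n : ℝ) : ℂ) else 0)
    (y : Fin n → ℂ) : ‖fiberProj b y‖ ≤ ‖y‖ := by
  set w := fiberProj b y with hw
  have h1 : ((‖w‖ ^ 2 : ℝ) : ℂ) = (n : ℂ)⁻¹ * ∑ a, y a * star (∑ k, b a k * w k) := by
    rw [EuclideanSpace.norm_sq_eq, Complex.ofReal_sum]
    have : ∀ k, ((‖w k‖ ^ 2 : ℝ) : ℂ) = (n : ℂ)⁻¹ * ∑ a, star (b a k) * y a * star (w k) := by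
      intro k
      rw [← Finset.sum_mul, ← mul_assoc, ← fiberProj_apply, ← hw]
      rw [RCLike.star_def, RCLike.mul_conj]; simp
    simp only [this, ← Finset.mul_sum, star_sum]
    rw [Finset.sum_comm]
    congr 1
    refine Finset.sum_congr rfl fun a _ => ?_
    rw [Finset.mul_sum]
    exact Finset.sum_congr rfl fun k _ => by rw [star_mul']; ring
  rcases Nat.eq_zero_or_pos n with hn | hn
  · subst hn
    have : w = 0 := by ext k; simp [hw, fiberProj_apply]
    rw [this]; simp
  have hn' : (0 : ℝ) < n := by exact_mod_cast hn
  have h2 : ‖w‖ ^ 2 ≤ (n : ℝ)⁻¹ * (‖y‖ * ∑ a, ‖∑ k, b a k * w k‖) := by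
    have := congrArg norm h1
    rw [norm_mul, norm_inv, RCLike.norm_natCast, Complex.norm_real,
      Real.norm_of_nonneg (sq_nonneg _)] at this
    rw [this, Finset.mul_sum]
    gcongr
    refine (norm_sum_le _ _).trans (Finset.sum_le_sum fun a _ => ?_)
    rw [norm_mul, norm_star]
    gcongr
    exact norm_le_pi_norm y a
  have h3 : ∑ a, ‖∑ k, b a k * w k‖ ≤ n * ‖w‖ := by
    refine abs_le_of_sq_le_sq' ?_ (by positivity) |>.2
    have := sq_sum_le_card_mul_sum_sq (s := Finset.univ) (f := fun a => ‖∑ k, b a k * w k‖)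
    rw [Finset.card_univ, Fintype.card_fin, sum_norm_sq_of_orthogonal hb,
      ← EuclideanSpace.norm_sq_eq] at this
    linarith
  have h4 : ‖w‖ ^ 2 ≤ ‖y‖ * ‖w‖ := by
    calc _ ≤ _ := h2
      _ ≤ (n : ℝ)⁻¹ * (‖y‖ * (n * ‖w‖)) := by gcongr
      _ = _ := by field_simp
  rcases (norm_nonneg w).eq_or_lt with h | h
  · rw [← h]; exact norm_nonneg y
  · rw [sq] at h4
    exact le_of_mul_le_mul_right h4 h

theorem norm_sumMap_fiberProj_le {n N : ℕ} {B : Fin n → Fin n → Fin N → ℂ}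
    (hB : ∀ x k l, ∑ a, star (B x a k) * B x a l = if k = l then ((n : ℝ) : ℂ) else 0)
    (z : L1Linfty n n) : ‖sumMap (fun x => fiberProj (B x)) z‖ ≤ ‖z‖ := by
  rw [sumMap_apply, PiLp.norm_eq_of_L1]
  exact (norm_sum_le _ _).trans (Finset.sum_le_sum fun x _ => norm_fiberProj_le (hB x) _)

theorem sumMap_fiberProj_embedMap {n N : ℕ} (hn : 0 < n) {B : Fin n → Fin n → Fin N → ℂ}
    (hB : ∀ x k l, ∑ a, star (B x a k) * B x a l = if k = l then ((n : ℝ) : ℂ) else 0)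
    (v : EuclideanSpace ℂ (Fin N)) : sumMap (fun x => fiberProj (B x)) (embedMap B v) = v := by
  have hn' : (n : ℂ) ≠ 0 := by exact_mod_cast hn.ne'
  ext k
  simp only [sumMap_apply, WithLp.ofLp_sum, Finset.sum_apply, fiberProj_apply, embedMap_apply]
  have h : ∀ x, ∑ a, star (B x a k) * ((n : ℂ)⁻¹ * ∑ l, B x a l * v l) = v k := by
    intro x
    calc _ = ∑ a, ∑ l, (n : ℂ)⁻¹ * v l * (star (B x a k) * B x a l) := by
          refine Finset.sum_congr rfl fun a _ => ?_
          rw [Finset.mul_sum, Finset.mul_sum]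
          exact Finset.sum_congr rfl fun l _ => by ring
      _ = ∑ l, (n : ℂ)⁻¹ * v l * (if k = l then ((n : ℝ) : ℂ) else 0) := by
          rw [Finset.sum_comm]
          exact Finset.sum_congr rfl fun l _ => by rw [← Finset.mul_sum, hB]
      _ = v k := by
          simp
          field_simp
  simp only [h]
  simp
  field_simp

/-! ### The norm of the embedding and the choice of signs. -/

/-- The embedding has norm of order `√(log n)` as soon as all the sums over `x` of one signed row
for each `x` satisfy a square function estimate. -/
theorem norm_embedMap_le {n N : ℕ} (hn : 0 < n) {B : Fin n → Fin n → Fin N → ℂ} {D : ℝ}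
    (hD : 0 ≤ D)
    (hB : ∀ i : Fin n → Fin n × Bool,
      ∑ k, ‖∑ x, boolSign (i x).2 * B x (i x).1 k‖ ^ 2 ≤ (n * D) ^ 2)
    (v : EuclideanSpace ℂ (Fin N)) : ‖embedMap B v‖ ≤ 2 * D * ‖v‖ := by
  have hn' : (0 : ℝ) < n := by exact_mod_cast hn
  have : Nonempty (Fin n) := ⟨⟨0, hn⟩⟩
  have hmax : ∀ x, ∃ a, ‖embedMap B v x‖ = ‖embedMap B v x a‖ := by
    intro x
    obtain ⟨a, -, ha⟩ := Finset.exists_max_image Finset.univ (fun a => ‖embedMap B v x a‖)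
      Finset.univ_nonempty
    exact ⟨a, le_antisymm ((pi_norm_le_iff_of_nonneg (norm_nonneg _)).2
      fun c => ha c (Finset.mem_univ c)) (norm_le_pi_norm _ a)⟩
  choose a ha using hmax
  -- With coordinates `a x` attaining the inner maxima and signs `θ` fixed, this is a linear
  -- functional of `v`, bounded by Cauchy–Schwarz over `k`.
  have hsigned : ∀ θ : Fin n → Bool,
      ‖∑ x, boolSign (θ x) * embedMap B v x (a x)‖ ≤ D * ‖v‖ := by
    intro θ
    have h1 : ∑ x, boolSign (θ x) * embedMap B v x (a x) =
        (n : ℂ)⁻¹ * ∑ k, (∑ x, boolSign (θ x) * B x (a x) k) * v k := by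
      simp only [embedMap_apply, Finset.mul_sum, Finset.sum_mul]
      rw [Finset.sum_comm]
      exact Finset.sum_congr rfl fun k _ => Finset.sum_congr rfl fun x _ => by ring
    rw [h1, norm_mul, norm_inv, RCLike.norm_natCast, inv_mul_le_iff₀ hn']
    refine (norm_sum_le _ _).trans ?_
    simp only [norm_mul]
    refine abs_le_of_sq_le_sq' ?_ (by positivity) |>.2
    refine (Finset.sum_mul_sq_le_sq_mul_sq _ _ _).trans ?_
    rw [← mul_assoc, mul_pow, EuclideanSpace.norm_sq_eq]
    gcongr
    exact hB fun x => (θ x, a x).swap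
  have hsign : ∀ r : ℝ, ∃ b : Bool, |r| = (boolSign b).re * r ∧ (boolSign b).im = 0 := by
    intro r
    rcases le_total 0 r with h | h
    · exact ⟨true, by simp [boolSign, abs_of_nonneg h]⟩
    · exact ⟨false, by simp [boolSign, abs_of_nonpos h]⟩
  -- Real signs recover absolute values of real numbers only, so real and imaginary parts are
  -- treated apart; this is the factor `2`.
  have hre : ∑ x, |(embedMap B v x (a x)).re| ≤ D * ‖v‖ := by
    choose θ hθ using fun x => hsign (embedMap B v x (a x)).re
    refine le_trans (le_of_eq ?_) ((Complex.re_le_norm _).trans (hsigned θ))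
    rw [Complex.re_sum]
    exact Finset.sum_congr rfl fun x _ => by rw [Complex.mul_re, (hθ x).2, (hθ x).1]; ring
  have him : ∑ x, |(embedMap B v x (a x)).im| ≤ D * ‖v‖ := by
    choose θ hθ using fun x => hsign (embedMap B v x (a x)).im
    refine le_trans (le_of_eq ?_) ((Complex.im_le_norm _).trans (hsigned θ))
    rw [Complex.im_sum]
    exact Finset.sum_congr rfl fun x _ => by rw [Complex.mul_im, (hθ x).2, (hθ x).1]; ring
  calc ‖embedMap B v‖ = ∑ x, ‖embedMap B v x (a x)‖ := by
        rw [PiLp.norm_eq_of_L1]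
        exact Finset.sum_congr rfl fun x _ => ha x
    _ ≤ ∑ x, (|(embedMap B v x (a x)).re| + |(embedMap B v x (a x)).im|) :=
        Finset.sum_le_sum fun x _ => Complex.norm_le_abs_re_add_abs_im _
    _ ≤ 2 * D * ‖v‖ := by rw [Finset.sum_add_distrib]; linarith

theorem exists_signed_fourier {n N : ℕ} (hn : 3 ≤ n) (hN : N ≤ n) :
    ∃ B : Fin n → Fin n → Fin N → ℂ,
      (∀ x k l, ∑ a, star (B x a k) * B x a l = if k = l then ((n : ℝ) : ℂ) else 0) ∧
      ∀ i : Fin n → Fin n × Bool, ∑ k, ‖∑ x, boolSign (i x).2 * B x (i x).1 k‖ ^ 2 ≤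
        (n * (5 * √(Real.log n))) ^ 2 := by
  have hn0 : 0 < n := by omega
  have hn' : (3 : ℝ) ≤ n := by exact_mod_cast hn
  have : Nonempty (Fin n) := ⟨⟨0, hn0⟩⟩
  have hz := Complex.isPrimitiveRoot_exp n hn0.ne'
  set z := Complex.exp (2 * Real.pi * Complex.I / n) with hzdef
  have hz1 : ‖z‖ = 1 := hz.norm'_eq_one hn0.ne'
  obtain ⟨e, he⟩ := exists_signs (ι := Fin n → Fin n × Bool) n N hn0
    (fun i x k => boolSign (i x).2 * z ^ (((i x).1 : ℕ) * (k : ℕ)))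
    (fun i x k => by rw [norm_mul, norm_pow, hz1, norm_boolSign]; simp)
  refine ⟨fun x a k => z ^ ((a : ℕ) * (k : ℕ)) * boolSign (e k x), fun x k l => ?_, fun i => ?_⟩
  · have hf := sum_star_fourier_mul hn0 hz (k.2.trans_le hN) (l.2.trans_le hN)
    calc _ = star (boolSign (e k x)) * boolSign (e l x) *
          ∑ a : Fin n, star (z ^ ((a : ℕ) * (k : ℕ))) * z ^ ((a : ℕ) * (l : ℕ)) := by
          rw [Finset.mul_sum]
          exact Finset.sum_congr rfl fun a _ => by rw [star_mul']; ring
      _ = _ := by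
          rw [hf]
          by_cases h : k = l
          · subst h; rw [star_boolSign_mul_self]; simp
          · simp [h, Fin.val_inj]
  · simp only [← mul_assoc]
    refine (he i).trans ?_
    -- Here `n ≥ 3 > e` is used, so that `N / 4` is absorbed by `n log n`.
    have hlog1 : 1 ≤ Real.log n := by
      rw [Real.le_log_iff_exp_le (by linarith)]
      exact Real.exp_one_lt_d9.le.trans (by linarith)
    have hlog2 : Real.log 2 ≤ Real.log n := Real.log_le_log (by norm_num) (by linarith)
    have hcard : Real.log (Fintype.card (Fin n → Fin n × Bool)) ≤ n * (2 * Real.log n) := by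
      simp only [Fintype.card_fun, Fintype.card_prod, Fintype.card_fin, Fintype.card_bool]
      push_cast
      rw [Real.log_pow, Real.log_mul (by positivity) (by norm_num)]
      gcongr
      linarith
    have hNn : (N : ℝ) / 4 ≤ n * Real.log n := by
      have : (N : ℝ) ≤ n := by exact_mod_cast hN
      nlinarith
    rw [mul_pow, Real.sq_sqrt (by linarith)]
    -- The constant is `8 · (2 + 1) = 24 ≤ 5²`.
    calc 8 * (n : ℝ) * (Real.log (Fintype.card (Fin n → Fin n × Bool)) + N / 4)
        ≤ 8 * (n : ℝ) * (n * (2 * Real.log n) + n * Real.log n) := by gcongr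
      _ ≤ ((n : ℝ) * 5) ^ 2 * Real.log n := by
        have : 0 ≤ (n : ℝ) ^ 2 * Real.log n := by positivity
        nlinarith

/-! ### Assembly. -/

theorem exists_isComplementedPair {n N : ℕ} (hn : 3 ≤ n) (hN : N ≤ n) :
    ∃ (V : EuclideanSpace ℂ (Fin N) →L[ℂ] L1Linfty n n)
      (V' : L1Linfty n n →L[ℂ] EuclideanSpace ℂ (Fin N)), IsComplementedPair 10 1 n N V V' := by
  obtain ⟨B, hB, hsq⟩ := exists_signed_fourier hn hN
  have hn0 : 0 < n := by omega
  refine ⟨(embedMap B).mkContinuous (2 * (5 * √(Real.log n)))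
      (norm_embedMap_le hn0 (by positivity) hsq),
    (sumMap fun x => fiberProj (B x)).mkContinuous 1
      (fun z => by rw [one_mul]; exact norm_sumMap_fiberProj_le hB z), ?_, ?_, ?_, ?_⟩
  · refine (LinearMap.mkContinuous_norm_le _ (by positivity) _).trans (le_of_eq ?_)
    ring
  · exact LinearMap.mkContinuous_norm_le _ zero_le_one _
  · ext1 v
    exact sumMap_fiberProj_embedMap hn0 hB v
  · rw [ENNReal.ofReal_one]
    exact cbNormLe_sumMap_fiberProj hB

theorem isComplementedPair_zero (C : ℝ) (n : ℕ) (h : 0 ≤ C) :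
    IsComplementedPair C 1 n 0 0 0 := by
  refine ⟨by rw [norm_zero]; positivity, by simp, Subsingleton.elim _ _, fun d X => ?_⟩
  have : blockOp ((X.map (0 : L1Linfty n n →L[ℂ] EuclideanSpace ℂ (Fin 0))).map
      (fun v => Matrix.toEuclideanCLM (𝕜 := ℂ) (rowMap 0 0 v))) = 0 := Subsingleton.elim _ _
  refine le_trans (le_of_eq ?_) zero_le
  simp only [rowNorms, bhNorms]
  refine (congrArg _ this).trans ?_
  rw [← ofReal_norm, ContinuousLinearMap.opNorm_zero, ENNReal.ofReal_zero]

theorem mainTheorem9 :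
    (∃ δ : ℝ, 0 < δ ∧ δ < 1 / 2 ∧ ∃ C K : ℝ, ∀ n : ℕ,
      ∃ (V : EuclideanSpace ℂ (Fin ⌊δ * n⌋₊) →L[ℂ] L1Linfty n n)
        (V' : L1Linfty n n →L[ℂ] EuclideanSpace ℂ (Fin ⌊δ * n⌋₊)),
        IsComplementedPair C K n ⌊δ * n⌋₊ V V') ∧
    (∀ C : ℝ, ∃ A : ℝ, ∀ (δ K : ℝ), 0 < δ → δ < 1 / 2 → ∀ (n : ℕ)
      (V : EuclideanSpace ℂ (Fin ⌊δ * n⌋₊) →L[ℂ] L1Linfty n n)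
      (V' : L1Linfty n n →L[ℂ] EuclideanSpace ℂ (Fin ⌊δ * n⌋₊)),
      IsComplementedPair C K n ⌊δ * n⌋₊ V V' →
        minNorm (l1LinftyNorms n n) (steeringElement V) ≤
          ENNReal.ofReal (A * √(n * Real.log n))) := by
  refine ⟨⟨1 / 4, by norm_num, by norm_num, 10, 1, fun n => ?_⟩, fun C => ⟨C, ?_⟩⟩
  · rcases lt_or_ge n 3 with hn | hn
    · have h0 : ⌊(1 / 4 : ℝ) * n⌋₊ = 0 := by
        rw [Nat.floor_eq_zero]
        have : (n : ℝ) < 3 := by exact_mod_cast hn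
        linarith
      rw [h0]
      exact ⟨0, 0, isComplementedPair_zero 10 n (by norm_num)⟩
    · refine exists_isComplementedPair hn (Nat.floor_le_of_le ?_)
      have : (0 : ℝ) ≤ n := Nat.cast_nonneg n
      linarith
  · intro δ K _ _ n V V' h
    refine (minNorm_steeringElement_le V).trans (ENNReal.ofReal_le_ofReal ?_)
    rw [Real.sqrt_mul (Nat.cast_nonneg n), mul_left_comm]
    exact mul_le_mul_of_nonneg_left h.1 (Real.sqrt_nonneg _)
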